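/- For $t\ge 0$ and a complex number $q$ with $|q|<1$ put $$V_t(q)=\sum_{1\le k_1\le k_2\le\cdots\le k_t}\ \prod_{j=1}^{t}\frac{q^{k_j}}{(1-q^{k_j})^2}\qquad(V_0=1),$$ an absolutely convergent series. Let $\Gamma\subseteq SL_2(\mathbb Z)$ be a congruence subgroup and $k$ an integer. An almost holomorphic modular form of weight $k$ for $\Gamma$ is a function on the upper half plane of the form $F(\tau)=\sum_{r=0}^{p} f_r(\tau)\,y^{-r}$ ($y=\operatorname{Im}\tau$, each $f_r$ holomorphic) that is invariant under the weight $k$ slash action of $\Gamma$ and is bounded at all cusps, i.e. $F|_k g$ is bounded as $y\to\infty$ for every $g\in SL_2(\mathbb Z)$. A quasi-modular form of weight $k$ for $\Gamma$ is the constant term $f_0$ of such an $F$. **Theorem.** There is a congruence subgroup $\Gamma$ of $SL_2(\mathbb Z)$ such that for every $t\ge 0$ the function $\tau\mapsto V_t(e^{2\pi i\tau})$ belongs to the ring of quasi-modular forms for $\Gamma$ and has weight at most $2t$ there: it is a finite sum of quasi-modular forms for $\Gamma$ of weights between $0$ and $2t$. -/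

import Mathlib

open scoped MatrixGroups ModularForm Manifold

noncomputable section

/-- The summand `∏ⱼ q^{kⱼ} / (1 - q^{kⱼ})²` attached to a weakly increasing tuple
`1 ≤ k₁ ≤ k₂ ≤ ⋯ ≤ kₜ` of positive integers. -/
def macMahonVTerm (t : ℕ) (q : ℂ) (k : Fin t →o ℕ+) : ℂ :=
  ∏ j, q ^ (k j : ℕ) / (1 - q ^ (k j : ℕ)) ^ 2

/-- `V_t(q) = ∑_{1 ≤ k₁ ≤ ⋯ ≤ kₜ} ∏ⱼ q^{kⱼ} / (1 - q^{kⱼ})²`. -/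
def macMahonV (t : ℕ) (q : ℂ) : ℂ :=
  ∑' k : Fin t →o ℕ+, macMahonVTerm t q k

/-- The nome `q = exp(2πiτ)`. -/
def nome (τ : UpperHalfPlane) : ℂ :=
  Complex.exp (2 * Real.pi * Complex.I * (τ : ℂ))

/-- The function `τ ↦ ∑_{r ≤ p} f_r(τ) / y^r`, where `y = Im τ`. -/
def imInvPolynomial (p : ℕ) (f : ℕ → UpperHalfPlane → ℂ) (τ : UpperHalfPlane) : ℂ :=
  ∑ r ∈ Finset.range (p + 1), f r τ / (τ.im : ℂ) ^ r

/-- `F` is an almost holomorphic modular form of weight `k` for `Γ` with expansion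
`F = ∑_{r ≤ p} f_r / y^r`: the coefficients `f_r` are holomorphic on the upper half plane, `F` is
invariant under the weight `k` slash action of `Γ`, and `F` is bounded at every cusp. -/
structure IsAlmostHolomorphicModularForm (Γ : Subgroup SL(2, ℤ)) (k : ℤ)
    (p : ℕ) (f : ℕ → UpperHalfPlane → ℂ) (F : UpperHalfPlane → ℂ) : Prop where
  expansion : F = imInvPolynomial p f
  holo : ∀ r ≤ p, MDiff (f r)
  slash_eq : ∀ γ ∈ Γ, F ∣[k] γ = F
  bdd_at_cusps : ∀ g : SL(2, ℤ), UpperHalfPlane.IsBoundedAtImInfty (F ∣[k] g)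

/-- A quasi-modular form of weight `k` for `Γ` is the constant term `f_0` (with respect to `1/y`)
of an almost holomorphic modular form of weight `k` for `Γ`. -/
def IsQuasimodularForm (Γ : Subgroup SL(2, ℤ)) (k : ℤ) (φ : UpperHalfPlane → ℂ) : Prop :=
  ∃ (p : ℕ) (f : ℕ → UpperHalfPlane → ℂ) (F : UpperHalfPlane → ℂ),
    IsAlmostHolomorphicModularForm Γ k p f F ∧ f 0 = φ

/-- `φ` lies in the part of weight at most `n` of the ring of quasi-modular forms for `Γ`:
it is a sum of quasi-modular forms for `Γ` of weights `0, 1, …, n`. -/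
def IsQuasimodularOfWeightLE (Γ : Subgroup SL(2, ℤ)) (n : ℕ) (φ : UpperHalfPlane → ℂ) : Prop :=
  ∃ g : ℕ → UpperHalfPlane → ℂ,
    (∀ k ≤ n, IsQuasimodularForm Γ (k : ℤ) (g k)) ∧ φ = ∑ k ∈ Finset.range (n + 1), g k

end

/-! `V_t` is the complete homogeneous symmetric function `h_t` in the variables `x_n = q^n / (1 -
q^n)^2`. Newton's identity `(t+1) h_{t+1} = ∑ p_{i+1} h_{t-i}` reduces the claim, by induction on
`t`, to the power sums `p_{s+1} = ∑ x_n^{s+1}`. Expanding `(x / (1-x)^2)^{s+1} = ∑ C(m+s, 2s+1)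
x^m`, the binomial is an odd polynomial in `m` of degree `2s+1`. Hence `p_{s+1}` is a combination of
the series `∑ σ_{2j+1}(n) q^n`, `j ≤ s`, which up to constants are the Eisenstein series of weight
`2j+2`. These are quasi-modular of level one (`E₂` by its completion), so `p_{s+1}` has weight at
most `2s+2`, and the full modular group serves every `t`. -/

section SymmetricFunctions

open Filter Topology

/-! ### Newton's identity in finitely many variables -/

theorem finite_bounded_orderHom (t N : ℕ) :
    {k : Fin t →o ℕ+ | ∀ j, (k j : ℕ) ≤ N}.Finite := by
  have h : {f : Fin t → ℕ+ | ∀ j, f j ∈ PNat.val ⁻¹' Set.Iic N}.Finite :=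
    Set.Finite.pi' fun _ => (Set.finite_Iic N).preimage PNat.coe_injective.injOn
  refine (h.preimage (f := fun k : Fin t →o ℕ+ => (k : Fin t → ℕ+))
    DFunLike.coe_injective.injOn).subset fun k hk => hk

/-- The weakly increasing tuples of length `t` with values in `{1, …, N}`. -/
noncomputable def boundedTuples (t N : ℕ) : Finset (Fin t →o ℕ+) :=
  (finite_bounded_orderHom t N).toFinset

theorem mem_boundedTuples {t N : ℕ} {k : Fin t →o ℕ+} :
    k ∈ boundedTuples t N ↔ ∀ j, (k j : ℕ) ≤ N := by
  simp [boundedTuples]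

/-- The complete homogeneous symmetric polynomial of degree `t` evaluated at `x 1, …, x N`. -/
noncomputable def completeHomogeneous (x : ℕ → ℂ) (N t : ℕ) : ℂ :=
  ∑ k ∈ boundedTuples t N, ∏ j, x (k j : ℕ)

theorem completeHomogeneous_zero_right (x : ℕ → ℂ) (N : ℕ) :
    completeHomogeneous x N 0 = 1 := by
  have : boundedTuples 0 N = {⟨fun i => i.elim0, fun i => i.elim0⟩} := by
    ext k
    simp only [mem_boundedTuples, Finset.mem_singleton]
    exact ⟨fun _ => by ext i; exact i.elim0, fun _ i => i.elim0⟩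
  simp [completeHomogeneous, this]

theorem completeHomogeneous_zero_left (x : ℕ → ℂ) (t : ℕ) :
    completeHomogeneous x 0 (t + 1) = 0 := by
  have : boundedTuples (t + 1) 0 = ∅ := by
    ext k
    simp only [mem_boundedTuples, Finset.notMem_empty, iff_false, not_forall]
    exact ⟨0, by simp⟩
  simp [completeHomogeneous, this]

/-- The first `t` entries of a weakly increasing tuple of length `t + 1`. -/
def OrderHom.finInit {t : ℕ} {α : Type*} [Preorder α] (k : Fin (t + 1) →o α) : Fin t →o α :=
  ⟨fun j => k j.castSucc, fun _ _ h => k.monotone (Fin.castSucc_le_castSucc_iff.mpr h)⟩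

/-- Append an upper bound to a weakly increasing tuple. -/
def OrderHom.finSnoc {t : ℕ} {α : Type*} [Preorder α] (k : Fin t →o α) (a : α)
    (h : ∀ j, k j ≤ a) : Fin (t + 1) →o α :=
  ⟨Fin.snoc (α := fun _ => α) k a, by
    intro i j hij
    induction j using Fin.lastCases with
    | last =>
      induction i using Fin.lastCases with
      | last => simp
      | cast i => simpa using h i
    | cast j =>
      induction i using Fin.lastCases with
      | last => exact absurd hij (by simp [Fin.le_def])
      | cast i =>
        simp only [Fin.snoc_castSucc]
        exact k.monotone (Fin.castSucc_le_castSucc_iff.mp hij)⟩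

@[simp]
theorem OrderHom.finInit_apply {t : ℕ} {α : Type*} [Preorder α] (k : Fin (t + 1) →o α)
    (j : Fin t) : k.finInit j = k j.castSucc := rfl

@[simp]
theorem OrderHom.finSnoc_castSucc {t : ℕ} {α : Type*} [Preorder α] (k : Fin t →o α) (a : α)
    (h : ∀ j, k j ≤ a) (j : Fin t) : k.finSnoc a h j.castSucc = k j :=
  Fin.snoc_castSucc (α := fun _ => α) a k j

@[simp]
theorem OrderHom.finSnoc_last {t : ℕ} {α : Type*} [Preorder α] (k : Fin t →o α) (a : α)
    (h : ∀ j, k j ≤ a) : k.finSnoc a h (Fin.last t) = a :=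
  Fin.snoc_last (α := fun _ => α) a k

/-- Split by the last entry: either it is at most `N`, or it equals `N + 1` and can be deleted. -/
theorem completeHomogeneous_succ (x : ℕ → ℂ) (N t : ℕ) :
    completeHomogeneous x (N + 1) (t + 1) =
      completeHomogeneous x N (t + 1) + x (N + 1) * completeHomogeneous x (N + 1) t := by
  classical
  have hlast : ∀ (k : Fin (t + 1) →o ℕ+) (j : Fin (t + 1)), (k j : ℕ) ≤ k (Fin.last t) :=
    fun k j => PNat.coe_le_coe _ _ |>.mpr (k.monotone (Fin.le_last j))
  unfold completeHomogeneous
  rw [← Finset.sum_filter_add_sum_filter_not (boundedTuples (t + 1) (N + 1))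
    (fun k => (k (Fin.last t) : ℕ) ≤ N)]
  congr 1
  · refine Finset.sum_congr ?_ fun _ _ => rfl
    ext k
    simp only [Finset.mem_filter, mem_boundedTuples]
    exact ⟨fun h j => (hlast k j).trans h.2, fun h => ⟨fun j => (h j).trans (by simp), h _⟩⟩
  · rw [Finset.mul_sum]
    refine Finset.sum_bij' (fun k _ => k.finInit)
      (fun k hk => k.finSnoc N.succPNat fun j => by
        rw [← PNat.coe_le_coe]; exact mem_boundedTuples.mp hk j) ?_ ?_ ?_ ?_ ?_
    · intro k hk
      simp only [Finset.mem_filter, mem_boundedTuples] at hk ⊢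
      exact fun j => hk.1 _
    · intro k hk
      simp only [Finset.mem_filter, mem_boundedTuples] at hk ⊢
      refine ⟨fun j => ?_, by simp⟩
      induction j using Fin.lastCases with
      | last => simp
      | cast j => simpa using hk j
    · intro k hk
      simp only [Finset.mem_filter, mem_boundedTuples, not_le] at hk
      have h1 : k (Fin.last t) = N.succPNat :=
        PNat.coe_injective (le_antisymm (hk.1 _) hk.2)
      ext j
      induction j using Fin.lastCases with
      | last => simp [h1]
      | cast j => simp
    · intro k hk
      ext j
      simp
    · intro k hk
      simp only [Finset.mem_filter, mem_boundedTuples, not_le] at hk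
      have h1 : (k (Fin.last t) : ℕ) = N + 1 := le_antisymm (hk.1 _) hk.2
      rw [Fin.prod_univ_castSucc, h1, mul_comm]
      rfl

open PowerSeries in
-- This is the logarithmic derivative of `∏ 1 / (1 - x_k X)`, built up one factor at a time.
theorem derivative_completeHomogeneous (x : ℕ → ℂ) (N : ℕ) :
    d⁄dX ℂ (PowerSeries.mk (completeHomogeneous x N)) =
      PowerSeries.mk (fun i => ∑ k ∈ Finset.Icc 1 N, x k ^ (i + 1)) *
        PowerSeries.mk (completeHomogeneous x N) := by
  induction N with
  | zero =>
    ext n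
    rw [PowerSeries.coeff_derivative]
    simp [completeHomogeneous_zero_left, PowerSeries.coeff_mul]
  | succ N ih =>
    set H := PowerSeries.mk (completeHomogeneous x N)
    set H' := PowerSeries.mk (completeHomogeneous x (N + 1))
    set a := x (N + 1)
    set G : PowerSeries ℂ := PowerSeries.mk (fun i => a ^ (i + 1))
    set P := PowerSeries.mk (fun i => ∑ k ∈ Finset.Icc 1 N, x k ^ (i + 1))
    have h1 : H = H' - C a * (X * H') := by
      ext n
      cases n with
      | zero => simp [H, H', completeHomogeneous_zero_right]
      | succ n => simp [H, H', completeHomogeneous_succ, coeff_succ_X_mul, a]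
    have h2 : G - C a * (X * G) = C a := by
      ext n
      cases n with
      | zero => simp [G]
      | succ n => simp [G, coeff_succ_X_mul, pow_succ']
    have h3 : PowerSeries.mk (fun i => ∑ k ∈ Finset.Icc 1 (N + 1), x k ^ (i + 1)) = P + G := by
      ext n
      simp [P, G, a, Finset.sum_Icc_succ_top]
    rw [h3]
    -- `h1` and `h2` say `H = (1 - aX) H'` and `(1 - aX) G = a`; cancelling `1 - aX` avoids
    -- inverting it.
    have hne : (1 - C a * X : PowerSeries ℂ) ≠ 0 := by
      intro h
      have := congrArg (coeff 0) h
      simp at this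
    apply mul_left_cancel₀ hne
    have h4 : d⁄dX ℂ H = d⁄dX ℂ H' - C a * (H' + X * d⁄dX ℂ H') := by
      rw [h1, map_sub, Derivation.leibniz, Derivation.leibniz]
      simp only [smul_eq_mul, derivative_C, derivative_X]
      ring
    rw [ih] at h4
    linear_combination -h4 + P * h1 - H' * h2

/-- Newton's identity for the complete homogeneous symmetric polynomials. -/
theorem completeHomogeneous_newton (x : ℕ → ℂ) (N t : ℕ) :
    completeHomogeneous x N (t + 1) * (t + 1) =
      ∑ ij ∈ Finset.HasAntidiagonal.antidiagonal t,
        (∑ k ∈ Finset.Icc 1 N, x k ^ (ij.1 + 1)) * completeHomogeneous x N ij.2 := by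
  have h := congrArg (PowerSeries.coeff t) (derivative_completeHomogeneous x N)
  rw [PowerSeries.coeff_derivative, PowerSeries.coeff_mul] at h
  simpa using h

/-! ### Passage to infinitely many variables -/

theorem summable_prod_pi {ι : Type*} {x : ι → ℝ} (hx0 : ∀ i, 0 ≤ x i) (hx : Summable x) (t : ℕ) :
    Summable fun f : Fin t → ι => ∏ j, x (f j) := by
  induction t with
  | zero => exact Summable.of_finite
  | succ t ih =>
    rw [← (Fin.consEquiv fun _ : Fin (t + 1) => ι).summable_iff]
    refine (hx.mul_of_nonneg ih hx0 fun f => Finset.prod_nonneg fun _ _ => hx0 _).congr ?_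
    intro p
    simp [Fin.consEquiv, Fin.prod_univ_succ]

theorem summable_prod_orderHom {x : ℕ → ℂ} (hx : Summable fun n : ℕ+ => x n) (t : ℕ) :
    Summable fun k : Fin t →o ℕ+ => ∏ j, x (k j : ℕ) := by
  refine Summable.of_norm ?_
  have h := (summable_prod_pi (fun n : ℕ+ => norm_nonneg (x n)) hx.norm t).comp_injective
    (i := fun k : Fin t →o ℕ+ => (k : Fin t → ℕ+)) DFunLike.coe_injective
  exact h.congr fun k => by simp

theorem tendsto_completeHomogeneous {x : ℕ → ℂ} (hx : Summable fun n : ℕ+ => x n) (t : ℕ) :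
    Tendsto (fun N => completeHomogeneous x N t) atTop
      (𝓝 (∑' k : Fin t →o ℕ+, ∏ j, x (k j : ℕ))) := by
  refine (summable_prod_orderHom hx t).hasSum.comp (tendsto_atTop_finset_of_monotone ?_ ?_)
  · intro M N hMN k hk
    rw [mem_boundedTuples] at hk ⊢
    exact fun j => (hk j).trans hMN
  · intro k
    refine ⟨∑ j, (k j : ℕ), mem_boundedTuples.mpr fun j => ?_⟩
    exact Finset.single_le_sum (f := fun j => (k j : ℕ)) (fun _ _ => Nat.zero_le _)
      (Finset.mem_univ j)

theorem tendsto_sum_Icc_one {f : ℕ → ℂ} (hf : Summable fun n : ℕ+ => f n) :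
    Tendsto (fun N => ∑ k ∈ Finset.Icc 1 N, f k) atTop (𝓝 (∑' n : ℕ+, f n)) := by
  have h1 : Summable fun n => f (n + 1) := summable_pnat_iff_summable_succ.mp hf
  rw [tsum_pnat_eq_tsum_succ (f := f)]
  refine h1.hasSum.tendsto_sum_nat.congr fun N => ?_
  rw [Finset.range_eq_Ico, Finset.sum_Ico_add' f 0 N 1, zero_add]
  rfl

theorem tsum_orderHom_newton {x : ℕ → ℂ} (hx : ∀ i, Summable fun n : ℕ+ => x n ^ (i + 1)) (t : ℕ) :
    (∑' k : Fin (t + 1) →o ℕ+, ∏ j, x (k j : ℕ)) * (t + 1) =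
      ∑ ij ∈ Finset.HasAntidiagonal.antidiagonal t,
        (∑' n : ℕ+, x n ^ (ij.1 + 1)) * ∑' k : Fin ij.2 →o ℕ+, ∏ j, x (k j : ℕ) := by
  have h1 : Summable fun n : ℕ+ => x n := by simpa using hx 0
  refine tendsto_nhds_unique ((tendsto_completeHomogeneous h1 (t + 1)).mul_const _) ?_
  simp_rw [completeHomogeneous_newton]
  exact tendsto_finsetSum _ fun ij _ =>
    (tendsto_sum_Icc_one (f := fun n => x n ^ (ij.1 + 1)) (hx ij.1)).mul
      (tendsto_completeHomogeneous h1 ij.2)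

/-! ### Power sums as divisor-sum series -/

/-- Recursion behind `(2s+1)! C(m+s, 2s+1) = m ∏_{i=1}^{s} (m² - i²)`, which shows the binomial to
be odd in `m`. -/
theorem Nat.choose_add_two_mul_eq (m s : ℕ) :
    ((m + (s + 1)).choose (2 * (s + 1) + 1) : ℂ) * ((2 * s + 3) * (2 * s + 2)) =
      (m + s).choose (2 * s + 1) * ((m : ℂ) ^ 2 - (s + 1) ^ 2) := by
  rcases lt_trichotomy m (s + 1) with h | h | h
  · rw [Nat.choose_eq_zero_of_lt (by omega), Nat.choose_eq_zero_of_lt (by omega)]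
    simp
  · rw [Nat.choose_eq_zero_of_lt (by omega), h]
    simp
  · obtain ⟨r, rfl⟩ := Nat.exists_eq_add_of_lt h
    have e1 := Nat.add_one_mul_choose_eq (s + 1 + r + 1 + s) (2 * s + 2)
    have e2 := Nat.choose_succ_right_eq (s + 1 + r + 1 + s) (2 * s + 1)
    have e3 : s + 1 + r + 1 + s - (2 * s + 1) = r + 1 := by omega
    rw [e3] at e2
    have e1' := congrArg (Nat.cast : ℕ → ℂ) e1
    have e2' := congrArg (Nat.cast : ℕ → ℂ) e2
    rw [show s + 1 + r + 1 + (s + 1) = s + 1 + r + 1 + s + 1 by ring,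
      show 2 * (s + 1) + 1 = 2 * s + 2 + 1 by ring]
    push_cast at e1' e2' ⊢
    rw [show 2 * s + 1 + 1 = 2 * s + 2 by ring] at e2'
    linear_combination (-(2 * s + 2 : ℂ)) * e1' + (s + 1 + r + 1 + s + 1 : ℂ) * e2'

open Polynomial in
theorem exists_polynomial_choose_eq (s : ℕ) :
    ∃ P : ℂ[X], P.natDegree ≤ s ∧
      ∀ m : ℕ, ((m + s).choose (2 * s + 1) : ℂ) = m * P.eval ((m : ℂ) ^ 2) := by
  induction s with
  | zero => exact ⟨1, by simp, by simp⟩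
  | succ s ih =>
    obtain ⟨P, hP, h⟩ := ih
    refine ⟨P * ((X - C ((s + 1 : ℂ) ^ 2)) * C (((2 * s + 3) * (2 * s + 2) : ℂ)⁻¹)), ?_, ?_⟩
    · refine natDegree_mul_le_of_le hP (natDegree_mul_C_le _ _ |>.trans ?_)
      exact (natDegree_X_sub_C _).le
    · intro m
      have h2 := Nat.choose_add_two_mul_eq m s
      have hne : ((2 * s + 3) * (2 * s + 2) : ℂ) ≠ 0 := by
        norm_cast
      rw [h] at h2
      rw [eq_div_of_mul_eq hne h2]
      simp only [eval_mul, eval_sub, eval_X, eval_C]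
      ring

theorem exists_choose_eq_sum_odd_pow (s : ℕ) :
    ∃ c : ℕ → ℂ, ∀ m : ℕ, ((m + s).choose (2 * s + 1) : ℂ) =
      ∑ j ∈ Finset.range (s + 1), c j * (m : ℂ) ^ (2 * j + 1) := by
  obtain ⟨P, hP, h⟩ := exists_polynomial_choose_eq s
  refine ⟨P.coeff, fun m => ?_⟩
  rw [h, Polynomial.eval_eq_sum_range' (Nat.lt_succ_of_le hP), Finset.mul_sum]
  exact Finset.sum_congr rfl fun j _ => by ring

theorem hasSum_choose_mul_pow (s : ℕ) {x : ℂ} (hx : ‖x‖ < 1) :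
    HasSum (fun m : ℕ => ((m + s).choose (2 * s + 1) : ℂ) * x ^ m)
      ((x / (1 - x) ^ 2) ^ (s + 1)) := by
  rw [← hasSum_nat_add_iff' (s + 1), Finset.sum_eq_zero, sub_zero]
  · convert! (hasSum_choose_mul_geometric_of_norm_lt_one (2 * s + 1) hx).mul_left (x ^ (s + 1))
      using 1
    · ext n
      rw [show n + (s + 1) + s = n + (2 * s + 1) by ring]
      ring
    · rw [div_pow, ← pow_mul]
      ring
  · intro m hm
    rw [Nat.choose_eq_zero_of_lt (by have := Finset.mem_range.mp hm; omega)]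
    simp

open ArithmeticFunction ArithmeticFunction.sigma in
/-- The power sums of `q ^ k / (1 - q ^ k) ^ 2` are combinations of the generating functions of
odd divisor sums. -/
theorem exists_hasSum_powerSum (s : ℕ) :
    ∃ c : ℕ → ℂ, ∀ q : ℂ, ‖q‖ < 1 →
      HasSum (fun n : ℕ+ => (q ^ (n : ℕ) / (1 - q ^ (n : ℕ)) ^ 2) ^ (s + 1))
        (∑ j ∈ Finset.range (s + 1), c j * ∑' n : ℕ+, (σ (2 * j + 1) n : ℂ) * q ^ (n : ℕ)) := by
  obtain ⟨c, hc⟩ := exists_choose_eq_sum_odd_pow s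
  refine ⟨c, fun q hq => ?_⟩
  have hsum (j : ℕ) := summable_prod_mul_pow (2 * j + 1) hq
  have hj (j : ℕ) : HasSum (fun n : ℕ+ => ∑' m : ℕ+, (m : ℂ) ^ (2 * j + 1) * q ^ (n * m : ℕ))
      (∑' n : ℕ+, (σ (2 * j + 1) n : ℂ) * q ^ (n : ℕ)) := by
    rw [← tsum_prod_pow_eq_tsum_sigma _ hq]
    exact (hsum j).prod.hasSum
  have hS := hasSum_sum (s := Finset.range (s + 1)) fun j _ => (hj j).mul_left (c j)
  convert! hS using 2 with n
  have hn : ‖q ^ (n : ℕ)‖ < 1 := by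
    rw [norm_pow]
    exact pow_lt_one₀ (norm_nonneg _) hq n.ne_zero
  have hm := hasSum_choose_mul_pow s hn
  -- The `m = 0` term vanishes because `s < 2s + 1`, so the sum runs over positive `m`.
  rw [← hm.tsum_eq, hm.summable.tsum_eq_zero_add, Nat.choose_eq_zero_of_lt (by omega),
    Nat.cast_zero, zero_mul, zero_add, ← tsum_pnat_eq_tsum_succ
      (f := fun m : ℕ => ((m + s).choose (2 * s + 1) : ℂ) * (q ^ (n : ℕ)) ^ m)]
  simp_rw [hc, ← tsum_mul_left, Finset.sum_mul]
  rw [Summable.tsum_finsetSum fun j _ =>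
    (((hsum j).prod_factor n).mul_left (c j)).congr fun m => by rw [pow_mul, mul_assoc]]
  exact Finset.sum_congr rfl fun j _ => tsum_congr fun m => by rw [pow_mul, mul_assoc]

end SymmetricFunctions

/-! ### Almost holomorphic forms of level one and their weight filtration -/

section QuasimodularForms

open UpperHalfPlane Polynomial

/-- The function `τ ↦ 1 / Im τ`. -/
noncomputable def imInv (τ : ℍ) : ℂ := (τ.im : ℂ)⁻¹

/-- The polynomial `P` in `1 / Im τ` with holomorphic coefficients defines an almost holomorphic
modular form of weight `k` for the full modular group. -/
structure IsLevelOneAlmostHolomorphic (k : ℤ) (P : (ℍ → ℂ)[X]) : Prop where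
  holo : ∀ r, MDiff (P.coeff r)
  slash_eq : ∀ γ : SL(2, ℤ), P.eval imInv ∣[k] γ = P.eval imInv
  bdd : IsBoundedAtImInfty (P.eval imInv)

theorem IsLevelOneAlmostHolomorphic.isQuasimodularForm {k : ℤ} {P : (ℍ → ℂ)[X]}
    (h : IsLevelOneAlmostHolomorphic k P) : IsQuasimodularForm ⊤ k (P.coeff 0) := by
  refine ⟨P.natDegree, P.coeff, P.eval imInv, ⟨?_, fun r _ => h.holo r, fun γ _ => h.slash_eq γ,
    fun g => by rw [h.slash_eq]; exact h.bdd⟩, rfl⟩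
  ext τ
  simp [imInvPolynomial, Polynomial.eval_eq_sum_range, imInv, div_eq_mul_inv]

theorem IsLevelOneAlmostHolomorphic.mul {k l : ℤ} {P Q : (ℍ → ℂ)[X]}
    (hP : IsLevelOneAlmostHolomorphic k P) (hQ : IsLevelOneAlmostHolomorphic l Q) :
    IsLevelOneAlmostHolomorphic (k + l) (P * Q) where
  holo r := by
    rw [coeff_mul]
    exact MDifferentiable.sum fun ij _ => (hP.holo _).mul (hQ.holo _)
  slash_eq γ := by rw [eval_mul, ModularForm.mul_slash_SL2, hP.slash_eq, hQ.slash_eq]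
  bdd := by rw [eval_mul]; exact hP.bdd.mul hQ.bdd

theorem IsLevelOneAlmostHolomorphic.add {k : ℤ} {P Q : (ℍ → ℂ)[X]}
    (hP : IsLevelOneAlmostHolomorphic k P) (hQ : IsLevelOneAlmostHolomorphic k Q) :
    IsLevelOneAlmostHolomorphic k (P + Q) where
  holo r := by
    rw [coeff_add]
    exact (hP.holo _).add (hQ.holo _)
  slash_eq γ := by rw [eval_add, SlashAction.add_slash, hP.slash_eq, hQ.slash_eq]
  bdd := by rw [eval_add]; exact hP.bdd.add hQ.bdd

theorem IsLevelOneAlmostHolomorphic.C {k : ℤ} {f : ℍ → ℂ} (hf : MDiff f)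
    (hs : ∀ γ : SL(2, ℤ), f ∣[k] γ = f) (hb : IsBoundedAtImInfty f) :
    IsLevelOneAlmostHolomorphic k (Polynomial.C f) where
  holo r := by
    rw [coeff_C]
    split_ifs
    · exact hf
    · exact mdifferentiable_const
  slash_eq γ := by rw [eval_C, hs]
  bdd := by rwa [eval_C]

theorem isLevelOneAlmostHolomorphic_const (c : ℂ) :
    IsLevelOneAlmostHolomorphic 0 (C (Function.const ℍ c)) :=
  .C mdifferentiable_const (fun γ => ModularForm.is_invariant_const γ c)
    (Filter.const_boundedAtFilter _ c)

theorem isLevelOneAlmostHolomorphic_zero (k : ℤ) : IsLevelOneAlmostHolomorphic k 0 := by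
  rw [← Polynomial.C_0]
  exact .C mdifferentiable_const (fun γ => SlashAction.zero_slash k γ)
    zero_form_isBoundedAtImInfty

theorem isLevelOneAlmostHolomorphic_eisensteinSeries {k : ℕ} (hk : 3 ≤ k) :
    IsLevelOneAlmostHolomorphic k (C (ModularForm.E hk : ℍ → ℂ)) := by
  refine .C (ModularForm.E hk).holo' (fun γ => ?_) (ModularFormClass.bdd_at_infty _)
  exact (ModularForm.E hk).slash_action_eq' _ ⟨γ, rfl⟩

theorem isBoundedAtImInfty_imInv : IsBoundedAtImInfty imInv := by
  rw [isBoundedAtImInfty_iff]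
  refine ⟨1, 1, fun z hz => ?_⟩
  rw [imInv, norm_inv, Complex.norm_real, Real.norm_of_nonneg z.im_pos.le]
  exact inv_le_one_of_one_le₀ hz

/-- From `1 / Im γz = |cz+d|² / y` and `conj (cz+d) = (cz+d) - 2icy`. -/
theorem imInv_slash_two (γ : SL(2, ℤ)) (z : ℍ) :
    (imInv ∣[(2 : ℤ)] γ) z = imInv z - 2 * Complex.I * (γ 1 0 : ℤ) / denom γ z := by
  rw [ModularForm.SL_slash_apply, imInv, imInv, ModularGroup.im_smul_eq_div_normSq]
  have hd : denom γ z ≠ 0 := denom_ne_zero γ z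
  have hy : (z.im : ℂ) ≠ 0 := by exact_mod_cast z.im_ne_zero
  have hn := Complex.mul_conj (denom γ z)
  have hc : (starRingEnd ℂ) (denom γ z) = denom γ z - 2 * Complex.I * (γ 1 0 : ℤ) * z.im := by
    rw [ModularGroup.denom_apply]
    apply Complex.ext <;> simp
    ring
  rw [Complex.ofReal_div, inv_div, ← hn, hc]
  field_simp

/-- The non-holomorphic modular Eisenstein series `E₂ - 3 / (π Im τ)`. -/
theorem isLevelOneAlmostHolomorphic_E2 :
    IsLevelOneAlmostHolomorphic 2
      (C EisensteinSeries.E2 + C (Function.const ℍ (-3 / Real.pi : ℂ)) * X) where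
  holo r := by
    rw [coeff_add, coeff_C, coeff_C_mul, coeff_X]
    refine MDifferentiable.add ?_ (MDifferentiable.mul mdifferentiable_const ?_)
    · split_ifs
      · exact E2_mdifferentiable
      · exact mdifferentiable_const
    · split_ifs
      · exact mdifferentiable_const
      · exact mdifferentiable_const
  slash_eq γ := by
    simp only [eval_add, eval_mul, eval_C, eval_X]
    have hsmul : (Function.const ℍ (-3 / Real.pi : ℂ)) * imInv = (-3 / Real.pi : ℂ) • imInv := rfl
    rw [hsmul, SlashAction.add_slash, ModularForm.SL_smul_slash, EisensteinSeries.E2_slash_action]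
    ext z
    -- With `ζ(2) = π²/6`, the defect of `E₂` is `-6ic / (π(cz+d))`; the factor `-3/π` makes `1/y`
    -- contribute its negative.
    have hpi : (Real.pi : ℂ) ≠ 0 := by exact_mod_cast Real.pi_ne_zero
    have hd : denom γ z ≠ 0 := denom_ne_zero γ z
    simp only [Pi.add_apply, Pi.sub_apply, Pi.smul_apply, smul_eq_mul, imInv_slash_two,
      EisensteinSeries.D2, riemannZeta_two]
    field_simp
    ring
  bdd := by
    simp only [eval_add, eval_mul, eval_C, eval_X]
    exact EisensteinSeries.isBoundedAtImInfty_E2.add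
      ((Filter.const_boundedAtFilter _ _).mul isBoundedAtImInfty_imInv)

/-- The span of the constant terms of almost holomorphic modular forms of level one and weight at
most `n`. -/
noncomputable def quasimodularLE (n : ℕ) : Submodule ℂ (ℍ → ℂ) :=
  Submodule.span ℂ {φ | ∃ k ≤ n, ∃ P, IsLevelOneAlmostHolomorphic (k : ℤ) P ∧ P.coeff 0 = φ}

theorem quasimodularLE_mono : Monotone quasimodularLE := fun _ _ h =>
  Submodule.span_mono fun _ ⟨k, hk, hP⟩ => ⟨k, hk.trans h, hP⟩

theorem coeff_zero_mem_quasimodularLE {k : ℕ} {P : (ℍ → ℂ)[X]}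
    (hP : IsLevelOneAlmostHolomorphic k P) : P.coeff 0 ∈ quasimodularLE k :=
  Submodule.subset_span ⟨k, le_rfl, P, hP, rfl⟩

theorem mul_mem_quasimodularLE {m n : ℕ} {f g : ℍ → ℂ} (hf : f ∈ quasimodularLE m)
    (hg : g ∈ quasimodularLE n) : f * g ∈ quasimodularLE (m + n) := by
  have h := Submodule.mul_mem_mul hf hg
  rw [quasimodularLE, quasimodularLE, Submodule.span_mul_span] at h
  refine Submodule.span_mono ?_ h
  rintro _ ⟨_, ⟨k, hk, P, hP, rfl⟩, _, ⟨l, hl, Q, hQ, rfl⟩, rfl⟩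
  exact ⟨k + l, add_le_add hk hl, P * Q, by exact_mod_cast hP.mul hQ, mul_coeff_zero P Q⟩

theorem one_mem_quasimodularLE (n : ℕ) : (1 : ℍ → ℂ) ∈ quasimodularLE n := by
  refine quasimodularLE_mono (Nat.zero_le n) ?_
  have h := coeff_zero_mem_quasimodularLE (k := 0)
    (by exact_mod_cast isLevelOneAlmostHolomorphic_const 1)
  rwa [coeff_C_zero] at h

/-- Elements of `quasimodularLE n` are sums of one quasimodular form in each weight up to `n`. -/
theorem isQuasimodularOfWeightLE_of_mem {n : ℕ} {φ : ℍ → ℂ} (h : φ ∈ quasimodularLE n) :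
    IsQuasimodularOfWeightLE ⊤ n φ := by
  suffices ∃ P : ℕ → (ℍ → ℂ)[X], (∀ k : ℕ, IsLevelOneAlmostHolomorphic k (P k)) ∧
      φ = ∑ k ∈ Finset.range (n + 1), (P k).coeff 0 by
    obtain ⟨P, hP, rfl⟩ := this
    exact ⟨fun k => (P k).coeff 0, fun k _ => (hP k).isQuasimodularForm, rfl⟩
  induction h using Submodule.span_induction with
  | mem φ h =>
    obtain ⟨k, hk, P, hP, rfl⟩ := h
    refine ⟨Pi.single k P, fun l => ?_, ?_⟩
    · by_cases hl : l = k
      · subst hl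
        simpa using hP
      · simpa [Pi.single_eq_of_ne hl] using isLevelOneAlmostHolomorphic_zero l
    · rw [Finset.sum_eq_single k]
      · simp
      · intro l _ hl
        simp [Pi.single_eq_of_ne hl]
      · intro h
        exact absurd (Finset.mem_range.mpr (by omega)) h
  | zero => exact ⟨fun _ => 0, fun k => isLevelOneAlmostHolomorphic_zero k, by simp⟩
  | add f g _ _ hf hg =>
    obtain ⟨P, hP, rfl⟩ := hf
    obtain ⟨Q, hQ, rfl⟩ := hg
    exact ⟨fun k => P k + Q k, fun k => (hP k).add (hQ k), by simp [Finset.sum_add_distrib]⟩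
  | smul c f _ hf =>
    obtain ⟨P, hP, rfl⟩ := hf
    refine ⟨fun k => C (Function.const ℍ c) * P k, fun k => ?_, ?_⟩
    · simpa using (isLevelOneAlmostHolomorphic_const c).mul (hP k)
    · simp only [coeff_C_mul, Finset.smul_sum]
      rfl

open ArithmeticFunction ArithmeticFunction.sigma in
/-- The generating functions of odd divisor sums are quasimodular. -/
theorem tsum_sigma_mem_quasimodularLE (j : ℕ) :
    (fun τ : ℍ => ∑' n : ℕ+, (σ (2 * j + 1) n : ℂ) * nome τ ^ (n : ℕ)) ∈
      quasimodularLE (2 * j + 2) := by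
  -- Solving for the series subtracts the constant `1`, of weight 0; hence only a bound on the
  -- weight.
  suffices ∃ E ∈ quasimodularLE (2 * j + 2), ∃ a : ℂ, a ≠ 0 ∧ ∀ τ : ℍ,
      E τ = 1 + a * ∑' n : ℕ+, (σ (2 * j + 1) n : ℂ) * nome τ ^ (n : ℕ) by
    obtain ⟨E, hE, a, ha, h⟩ := this
    convert! Submodule.smul_mem _ a⁻¹ (Submodule.sub_mem _ hE (one_mem_quasimodularLE _)) using 1
    ext τ
    simp [h, ha]
  rcases Nat.eq_zero_or_pos j with rfl | hj
  · refine ⟨EisensteinSeries.E2, ?_, -24, by norm_num, fun τ => ?_⟩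
    · have h := coeff_zero_mem_quasimodularLE (k := 2)
        (by exact_mod_cast isLevelOneAlmostHolomorphic_E2)
      simpa using h
    · rw [EisensteinSeries.E2_eq_tsum_cexp]
      simp [nome, sub_eq_add_neg]
  · have hk : 3 ≤ 2 * j + 2 := by omega
    have he : Even (2 * j + 2) := ⟨j + 1, by ring⟩
    have hz : riemannZeta (2 * j + 2 : ℕ) ≠ 0 :=
      riemannZeta_ne_zero_of_one_lt_re <| by norm_cast; omega
    refine ⟨ModularForm.E hk, ?_,
      (riemannZeta (2 * j + 2 : ℕ))⁻¹ * (-2 * Real.pi * Complex.I) ^ (2 * j + 2) /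
        (2 * j + 2 - 1).factorial, ?_, fun τ => ?_⟩
    · have h := coeff_zero_mem_quasimodularLE (isLevelOneAlmostHolomorphic_eisensteinSeries hk)
      rwa [coeff_C_zero] at h
    · push_cast at hz
      simp [hz, Nat.factorial_ne_zero, Real.pi_ne_zero]
    · rw [EisensteinSeries.q_expansion_riemannZeta hk he]
      simp [nome]

/-! ### Induction on `t` through Newton's identity -/

theorem norm_nome_lt_one (τ : ℍ) : ‖nome τ‖ < 1 := norm_exp_two_pi_I_lt_one τ

theorem summable_macMahonVTerm (t : ℕ) {q : ℂ} (hq : ‖q‖ < 1) : Summable (macMahonVTerm t q) := by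
  obtain ⟨c, hc⟩ := exists_hasSum_powerSum 0
  exact summable_prod_orderHom (x := fun n => q ^ n / (1 - q ^ n) ^ 2)
    (by simpa using (hc q hq).summable) t

theorem macMahonV_newton (t : ℕ) {q : ℂ} (hq : ‖q‖ < 1) :
    macMahonV (t + 1) q * (t + 1) = ∑ ij ∈ Finset.HasAntidiagonal.antidiagonal t,
      (∑' n : ℕ+, (q ^ (n : ℕ) / (1 - q ^ (n : ℕ)) ^ 2) ^ (ij.1 + 1)) * macMahonV ij.2 q := by
  refine tsum_orderHom_newton (x := fun n => q ^ n / (1 - q ^ n) ^ 2) (fun i => ?_) t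
  obtain ⟨c, hc⟩ := exists_hasSum_powerSum i
  exact (hc q hq).summable

theorem powerSum_mem_quasimodularLE (i : ℕ) :
    (fun τ : ℍ => ∑' n : ℕ+, (nome τ ^ (n : ℕ) / (1 - nome τ ^ (n : ℕ)) ^ 2) ^ (i + 1)) ∈
      quasimodularLE (2 * (i + 1)) := by
  obtain ⟨c, hc⟩ := exists_hasSum_powerSum i
  have h := Submodule.sum_mem (quasimodularLE (2 * (i + 1)))
    (t := Finset.range (i + 1)) (f := fun j => c j • fun τ : ℍ =>
      ∑' n : ℕ+, (ArithmeticFunction.sigma (2 * j + 1) n : ℂ) * nome τ ^ (n : ℕ)) fun j hj =>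
    Submodule.smul_mem _ _ (quasimodularLE_mono
      (by have := Finset.mem_range.mp hj; omega) (tsum_sigma_mem_quasimodularLE j))
  convert! h using 1
  ext τ
  rw [(hc (nome τ) (norm_nome_lt_one τ)).tsum_eq]
  simp

theorem macMahonV_nome_mem_quasimodularLE (t : ℕ) :
    (fun τ : ℍ => macMahonV t (nome τ)) ∈ quasimodularLE (2 * t) := by
  induction t using Nat.strong_induction_on with
  | _ t ih =>
    cases t with
    | zero =>
      convert! one_mem_quasimodularLE 0 using 1
      ext τ
      have : Unique (Fin 0 →o ℕ+) :=
        { default := ⟨fun i => i.elim0, fun i => i.elim0⟩, uniq := fun k => by ext i; exact i.elim0 }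
      simp [macMahonV, macMahonVTerm]
    | succ t =>
      have h := Submodule.sum_mem (quasimodularLE (2 * (t + 1)))
        (t := Finset.HasAntidiagonal.antidiagonal t) (f := fun ij =>
          (fun τ : ℍ => ∑' n : ℕ+, (nome τ ^ (n : ℕ) / (1 - nome τ ^ (n : ℕ)) ^ 2) ^ (ij.1 + 1)) *
            fun τ : ℍ => macMahonV ij.2 (nome τ)) fun ij hij => by
        have hij' := Finset.HasAntidiagonal.mem_antidiagonal.mp hij
        -- The weights add up: `2(i+1) + 2(t-i) = 2(t+1)`.
        exact quasimodularLE_mono (by omega)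
          (mul_mem_quasimodularLE (powerSum_mem_quasimodularLE ij.1) (ih ij.2 (by omega)))
      convert! Submodule.smul_mem _ ((t + 1 : ℂ)⁻¹) h using 1
      ext τ
      have ht : (t + 1 : ℂ) ≠ 0 := by exact_mod_cast Nat.succ_ne_zero t
      rw [eq_div_of_mul_eq ht (macMahonV_newton t (norm_nome_lt_one τ))]
      simp [div_eq_inv_mul]

theorem isCongruenceSubgroup_top : CongruenceSubgroup.IsCongruenceSubgroup ⊤ :=
  ⟨1, one_ne_zero, le_top⟩

end QuasimodularForms

theorem mainTheorem9 :
    ∃ Γ : Subgroup SL(2, ℤ), CongruenceSubgroup.IsCongruenceSubgroup Γ ∧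
      ∀ t : ℕ,
        (∀ q : ℂ, ‖q‖ < 1 → Summable (macMahonVTerm t q)) ∧
        IsQuasimodularOfWeightLE Γ (2 * t) (fun τ => macMahonV t (nome τ)) :=
  ⟨⊤, isCongruenceSubgroup_top, fun t => ⟨fun _ hq => summable_macMahonVTerm t hq,
    isQuasimodularOfWeightLE_of_mem (macMahonV_nome_mem_quasimodularLE t)⟩⟩
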